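/- Let $P$ be a non-empty countable set of atoms and $G$ a non-empty finite set of agents. Let $\mathcal C$ be one of the following classes of Kripke models (non-empty domain, one accessibility relation $R_a$ for each $a\in G$, a valuation of $P$): $\mathcal K$ (all models), $\mathcal{K}45$ (all $R_a$ transitive and Euclidean), $\mathcal S5$ (all $R_a$ reflexive, transitive and Euclidean). An action model $\mathsf M$ consists of a non-empty finite set of action points, one accessibility relation on it for each agent, and a precondition formula $\mathsf{pre}(\mathsf t)$ for each action point $\mathsf t$; $\mathsf{AM}_{\mathcal C}$ is the class of action models whose accessibility relations satisfy the conditions of $\mathcal C$ (so $\mathsf{AM}_{\mathcal K}$ contains all action models). The formulas of arbitrary action model logic for $\mathcal C$ are $$\varphi ::= p \mid \neg\varphi \mid (\varphi\wedge\varphi) \mid \Box_a\varphi \mid [\mathsf M_{\mathsf T}]\varphi \mid \forall\varphi,$$ where $p\in P$, $a\in G$, $\mathsf M\in\mathsf{AM}_{\mathcal C}$ has preconditions in this same language, $\mathsf T$ is a set of action points of $\mathsf M$, and $\forall$ is the refinement quantifier. Write $\langle\mathsf M_{\mathsf T}\rangle\varphi=\neg[\mathsf M_{\mathsf T}]\neg\varphi$,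 $\langle\mathsf M_{\mathsf s}\rangle=\langle\mathsf M_{\{\mathsf s\}}\rangle$ and $\exists\varphi=\neg\forall\neg\varphi$. Truth at a pointed model $M_s$ with $M\in\mathcal C$ is as usual for atoms, $\neg$, $\wedge$, $\Box_a$. The model $M\otimes\mathsf M$ has as states the pairs $(t,\mathsf t)$ with $M_t\models\mathsf{pre}(\mathsf t)$, with $(t,\mathsf t)R_a(u,\mathsf u)$ iff $tR_au$ and $\mathsf t\mathsf R_a\mathsf u$, and with the valuation inherited from the first component; $M_s\models[\mathsf M_{\mathsf T}]\varphi$ iff, provided that $M\otimes\mathsf M\in\mathcal C$, $\varphi$ is true at every state $(s,\mathsf t)$ of $M\otimes\mathsf M$ with $\mathsf t\in\mathsf T$. Finally, $M_s\models\forall\varphi$ iff $M'_{s'}\models\varphi$ for every refinement $M'_{s'}$ of $M_s$ with $M'\in\mathcal C$, where $M'_{s'}$ is a refinement of $M_s$ iff there is a relation $Z$ between the states of $M'$ and those of $M$ with $s'Zs$ such that whenever $t'Zt$, the states $t'$ and $t$ satisfy the same atoms and, for all $a\in G$ and $u'$ with $t'R'_au'$, there is $u$ with $tR_au$ and $u'Zu$.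 Then for each $\mathcal C\in\{\mathcal K,\mathcal K45,\mathcal S5\}$, every pointed model $M_s$ with $M\in\mathcal C$ and every formula $\varphi$ of arbitrary action model logic for $\mathcal C$: $M_s\models\exists\varphi$ if and only if there are an action model $\mathsf M\in\mathsf{AM}_{\mathcal C}$, with preconditions in the language for $\mathcal C$, and an action point $\mathsf s$ of $\mathsf M$ such that $M_s\models\langle\mathsf M_{\mathsf s}\rangle\varphi$. -/

import Mathlib

universe u v w

namespace AAML

/-- The three classes under consideration. -/
inductive FrameClass : Type
  | K
  | K45
  | S5

/-- The condition that a class puts on every accessibility relation. It is used both for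
Kripke models and for action models. -/
def FrameClass.Frame (C : FrameClass) {Agent : Type v} {S : Type w}
    (R : Agent → S → S → Prop) : Prop :=
  match C with
  | .K => True
  | .K45 => ∀ a,
      (∀ x y z, R a x y → R a y z → R a x z) ∧
      (∀ x y z, R a x y → R a x z → R a y z)
  | .S5 => ∀ a,
      (∀ x, R a x x) ∧
      (∀ x y z, R a x y → R a y z → R a x z) ∧
      (∀ x y z, R a x y → R a x z → R a y z)

/-- The accessibility relations and the valuation of a Kripke model with domain `S`.
Non-emptiness of the domain is part of `KripkeModel.InClass`. -/
structure KripkeModel (Atom : Type u) (Agent : Type v) (S : Type w) where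
  rel : Agent → S → S → Prop
  val : Atom → Set S

/-- The Kripke model belongs to the class `C`. -/
def KripkeModel.InClass {Atom : Type u} {Agent : Type v} {S : Type w}
    (M : KripkeModel Atom Agent S) (C : FrameClass) : Prop :=
  Nonempty S ∧ C.Frame M.rel

/-- `(M, s)` is a refinement of `(M', s')`: there is a simulation (atoms and forth)
from `M` to `M'` that relates `s` to `s'`. -/
def Refines {Atom : Type u} {Agent : Type v} {S S' : Type w}
    (M : KripkeModel Atom Agent S) (s : S) (M' : KripkeModel Atom Agent S') (s' : S') : Prop :=
  ∃ Z : S → S' → Prop,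
    (∀ x x', Z x x' → ∀ p, x ∈ M.val p ↔ x' ∈ M'.val p) ∧
    (∀ x x', Z x x' → ∀ a y, M.rel a x y → ∃ y', M'.rel a x' y' ∧ Z y y') ∧
    Z s s'

/-- An action model with preconditions in `L`: a finite non-empty domain of action points,
accessibility relations, and preconditions. -/
structure ActionModel (Agent : Type v) (L : Type u) where
  Point : Type
  finite : Finite Point
  nonempty : Nonempty Point
  rel : Agent → Point → Point → Prop
  pre : Point → L

/-- The action model belongs to the class of action models corresponding to `C`. -/
def ActionModel.InClass {Agent : Type v} {L : Type u}
    (A : ActionModel Agent L) (C : FrameClass) : Prop :=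
  C.Frame A.rel

/-- Formulas of arbitrary action model logic. The constructor `act` takes the components of a
multi-pointed action model whose preconditions are formulas; see `Form.boxAct`. -/
inductive Form (Atom : Type u) (Agent : Type v) : Type (max u v 1)
  | atom (p : Atom) : Form Atom Agent
  | neg (φ : Form Atom Agent) : Form Atom Agent
  | and (φ ψ : Form Atom Agent) : Form Atom Agent
  | box (a : Agent) (φ : Form Atom Agent) : Form Atom Agent
  | act (P : Type) (finite : Finite P) (nonempty : Nonempty P)
      (rel : Agent → P → P → Prop) (pre : P → Form Atom Agent) (T : Set P)
      (φ : Form Atom Agent) : Form Atom Agent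
  | allRef (φ : Form Atom Agent) : Form Atom Agent

/-- `[A_T] φ`. -/
def Form.boxAct {Atom : Type u} {Agent : Type v}
    (A : ActionModel Agent (Form Atom Agent)) (T : Set A.Point) (φ : Form Atom Agent) :
    Form Atom Agent :=
  .act A.Point A.finite A.nonempty A.rel A.pre T φ

/-- `⟨A_T⟩ φ`, an abbreviation of `¬ [A_T] ¬ φ`. -/
def Form.diaAct {Atom : Type u} {Agent : Type v}
    (A : ActionModel Agent (Form Atom Agent)) (T : Set A.Point) (φ : Form Atom Agent) :
    Form Atom Agent :=
  .neg (.boxAct A T (.neg φ))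

/-- The existential refinement quantifier, an abbreviation of `¬ ∀ref ¬ φ`. -/
def Form.someRef {Atom : Type u} {Agent : Type v} (φ : Form Atom Agent) : Form Atom Agent :=
  .neg (.allRef (.neg φ))

/-- The formula belongs to the language for the class `C`: every action model that occurs in it
(also inside preconditions) is in the class of action models corresponding to `C`. -/
def Form.InLang {Atom : Type u} {Agent : Type v} (C : FrameClass) : Form Atom Agent → Prop
  | .atom _ => True
  | .neg φ => φ.InLang C
  | .and φ ψ => φ.InLang C ∧ ψ.InLang C
  | .box _ φ => φ.InLang C
  | .act _ _ _ rel pre _ φ => C.Frame rel ∧ (∀ t, (pre t).InLang C) ∧ φ.InLang C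
  | .allRef φ => φ.InLang C

/-- The restricted product of a Kripke model with a family of relations on `P`, where `h s t`
says that the state `s` satisfies the precondition of `t`. -/
def KripkeModel.update {Atom : Type u} {Agent : Type v} {S : Type w} {P : Type}
    (M : KripkeModel Atom Agent S) (rel : Agent → P → P → Prop) (h : S → P → Prop) :
    KripkeModel Atom Agent {x : S × P // h x.1 x.2} where
  rel a x y := M.rel a x.1.1 y.1.1 ∧ rel a x.1.2 y.1.2
  val p := {x | x.1.1 ∈ M.val p}

/-- Truth of a formula at a state of a Kripke model, in the logic of the class `C`. -/
def Sat {Atom : Type u} {Agent : Type v} (C : FrameClass) :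
    Form Atom Agent → ∀ {S : Type w}, KripkeModel Atom Agent S → S → Prop
  | .atom p, _, M, s => s ∈ M.val p
  | .neg φ, _, M, s => ¬ Sat C φ M s
  | .and φ ψ, _, M, s => Sat C φ M s ∧ Sat C ψ M s
  | .box a φ, _, M, s => ∀ t, M.rel a s t → Sat C φ M t
  | .act _ _ _ rel pre T φ, _, M, s =>
      (M.update rel (fun x t => Sat C (pre t) M x)).InClass C →
        ∀ t ∈ T, ∀ h : Sat C (pre t) M s,
          Sat C φ (M.update rel (fun x t => Sat C (pre t) M x)) ⟨(s, t), h⟩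
  | .allRef φ, _, M, s =>
      ∀ (S' : Type w) (M' : KripkeModel Atom Agent S') (s' : S'),
        M'.InClass C → Refines M' s' M s → Sat C φ M' s'

/-- Over the class `K` the language is the full language. -/
theorem Form.inLang_K {Atom : Type u} {Agent : Type v} (φ : Form Atom Agent) :
    φ.InLang .K := by
  induction φ with
  | atom p => trivial
  | neg φ ih => exact ih
  | and φ ψ ih₁ ih₂ => exact ⟨ih₁, ih₂⟩
  | box a φ ih => exact ih
  | act P f n rel pre T φ ih₁ ih₂ => exact ⟨trivial, ih₁, ih₂⟩
  | allRef φ ih => exact ih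

end AAML

/-! Right to left, projecting an update to its first component is a simulation, so every update
lying in the class is a refinement. Left to right, two facts are combined. Invariance
(`Form.exists_invariant`): on the class, each formula depends only on the bisimulation type of some
depth `n` over finitely many atoms. Synthesis (`exists_actionModel_typ_eq`): given a refinement of a
pointed model, a finite action model turns that pointed model into one with the same type of depth
`n` as the refinement. The same action model works on every pointed model of the class with the
original type of depth `n`; this uniformity yields the case of the refinement quantifier in the
induction for invariance, so synthesis must come first. For synthesis, unravel the refinement to
depth `n`: action points are paths of agents and types realized from its root. The precondition of a
path says that the current state looks like one simulating the end of the path. It depends on a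
bounded type only, and there are finitely many types, so a modal formula expresses it. In K45 and S5
repeated steps of one agent must stay in one cluster, so such a step replaces the last step of the
path instead of extending it. -/

namespace AAML

/-! ### Bounded bisimulation types -/

/-- The bisimulation types of depth `k` over the atoms in `Q`. -/
def Ty {Atom : Type u} (Agent : Type v) (Q : Set Atom) : ℕ → Type (max u v)
  -- Depth 0 records nothing, not even atoms: paths of full length `n` then impose no condition on
  -- their end.
  | 0 => PUnit
  | k + 1 => Set Q × (Agent → Set (Ty Agent Q k))

theorem Ty.finite {Atom : Type u} {Agent : Type v} [Finite Agent] {Q : Set Atom}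
    (hQ : Q.Finite) : ∀ k, Finite (Ty Agent Q k)
  | 0 => inferInstanceAs (Finite PUnit)
  | k + 1 => by
    have := Ty.finite (Agent := Agent) hQ k
    have := hQ.to_subtype
    exact inferInstanceAs (Finite (Set Q × (Agent → Set (Ty Agent Q k))))

/-- The type of depth `k` of a state. -/
def typ {Atom : Type u} {Agent : Type v} (Q : Set Atom) :
    (k : ℕ) → {S : Type w} → KripkeModel Atom Agent S → S → Ty Agent Q k
  | 0, _, _, _ => PUnit.unit
  | k + 1, _, M, s => ({p | s ∈ M.val p}, fun a => {τ | ∃ t, M.rel a s t ∧ typ Q k M t = τ})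

/-- The types of depth `k` of the `a`-successors of a state. -/
def succTyp {Atom : Type u} {Agent : Type v} (Q : Set Atom) (k : ℕ) (a : Agent) {S : Type w}
    (M : KripkeModel Atom Agent S) (s : S) : Set (Ty Agent Q k) :=
  {τ | ∃ t, M.rel a s t ∧ typ Q k M t = τ}

section Types

variable {Atom : Type u} {Agent : Type v} {Q : Set Atom} {k : ℕ} {S S' : Type w}
  {M : KripkeModel Atom Agent S} {M' : KripkeModel Atom Agent S'} {s : S} {s' : S'}

theorem typ_succ_eq_iff_succTyp :
    typ Q (k + 1) M s = typ Q (k + 1) M' s' ↔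
      (∀ p ∈ Q, s ∈ M.val p ↔ s' ∈ M'.val p) ∧
        ∀ a, succTyp Q k a M s = succTyp Q k a M' s' := by
  constructor
  · intro h
    have h1 := congrArg Prod.fst h
    have h2 := congrArg Prod.snd h
    exact ⟨fun p hp => Set.ext_iff.mp h1 ⟨p, hp⟩, fun a => congrFun h2 a⟩
  · rintro ⟨h1, h2⟩
    exact Prod.ext (Set.ext fun p => h1 p p.2) (funext h2)

theorem succTyp_eq_of_typ_eq (h : typ Q (k + 1) M s = typ Q (k + 1) M' s') (a : Agent) :
    succTyp Q k a M s = succTyp Q k a M' s' :=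
  (typ_succ_eq_iff_succTyp.mp h).2 a

theorem exists_rel_of_succTyp_eq {a : Agent} {t : S}
    (h : succTyp Q k a M s = succTyp Q k a M' s') (ht : M.rel a s t) :
    ∃ t', M'.rel a s' t' ∧ typ Q k M' t' = typ Q k M t := by
  have : typ Q k M t ∈ succTyp Q k a M s := ⟨t, ht, rfl⟩
  rw [h] at this
  exact this

theorem typ_succ_eq_iff :
    typ Q (k + 1) M s = typ Q (k + 1) M' s' ↔
      (∀ p ∈ Q, s ∈ M.val p ↔ s' ∈ M'.val p) ∧
        ∀ a, (∀ t, M.rel a s t → ∃ t', M'.rel a s' t' ∧ typ Q k M t = typ Q k M' t') ∧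
          ∀ t', M'.rel a s' t' → ∃ t, M.rel a s t ∧ typ Q k M t = typ Q k M' t' := by
  rw [typ_succ_eq_iff_succTyp]
  refine and_congr_right fun _ => forall_congr' fun a => ⟨fun h => ⟨fun t ht => ?_, fun t ht => ?_⟩,
    fun ⟨h1, h2⟩ => Set.ext fun τ => ⟨?_, ?_⟩⟩
  · obtain ⟨t', h1, h2⟩ := exists_rel_of_succTyp_eq h ht
    exact ⟨t', h1, h2.symm⟩
  · exact exists_rel_of_succTyp_eq h.symm ht
  · rintro ⟨t, ht, rfl⟩
    obtain ⟨t', h3, h4⟩ := h1 t ht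
    exact ⟨t', h3, h4.symm⟩
  · rintro ⟨t, ht, rfl⟩
    exact h2 t ht

theorem typ_eq_of_subset {Q' : Set Atom} (hQ : Q ⊆ Q')
    (h : typ Q' k M s = typ Q' k M' s') : typ Q k M s = typ Q k M' s' := by
  induction k generalizing s s' with
  | zero => rfl
  | succ k ih =>
    rw [typ_succ_eq_iff] at h ⊢
    refine ⟨fun p hp => h.1 p (hQ hp), fun a => ⟨fun t ht => ?_, fun t ht => ?_⟩⟩
    · obtain ⟨t', h1, h2⟩ := (h.2 a).1 t ht
      exact ⟨t', h1, ih h2⟩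
    · obtain ⟨t', h1, h2⟩ := (h.2 a).2 t ht
      exact ⟨t', h1, ih h2⟩

theorem typ_eq_of_typ_succ_eq (h : typ Q (k + 1) M s = typ Q (k + 1) M' s') :
    typ Q k M s = typ Q k M' s' := by
  induction k generalizing s s' with
  | zero => rfl
  | succ k ih =>
    rw [typ_succ_eq_iff] at h ⊢
    refine ⟨h.1, fun a => ⟨fun t ht => ?_, fun t ht => ?_⟩⟩
    · obtain ⟨t', h1, h2⟩ := (h.2 a).1 t ht
      exact ⟨t', h1, ih h2⟩
    · obtain ⟨t', h1, h2⟩ := (h.2 a).2 t ht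
      exact ⟨t', h1, ih h2⟩

theorem typ_eq_of_le {m : ℕ} (hkm : k ≤ m) (h : typ Q m M s = typ Q m M' s') :
    typ Q k M s = typ Q k M' s' := by
  induction hkm with
  | refl => exact h
  | step _ ih => exact ih (typ_eq_of_typ_succ_eq h)

end Types

/-! ### Definability -/

/-- The property of pointed models is defined by a formula of the language for `C`. -/
def Definable {Atom : Type u} {Agent : Type v} (C : FrameClass)
    (P : ∀ S : Type w, KripkeModel Atom Agent S → S → Prop) : Prop :=
  ∃ ψ : Form Atom Agent, ψ.InLang C ∧ ∀ (S : Type w) (M : KripkeModel Atom Agent S) (s : S),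
    Sat C ψ M s ↔ P S M s

namespace Definable

variable {Atom : Type u} {Agent : Type v} {C : FrameClass}
  {P P' : ∀ S : Type w, KripkeModel Atom Agent S → S → Prop}

theorem congr (h : Definable C P) (e : ∀ S M s, P S M s ↔ P' S M s) : Definable C P' := by
  obtain ⟨ψ, h1, h2⟩ := h
  exact ⟨ψ, h1, fun S M s => (h2 S M s).trans (e S M s)⟩

theorem atom (p : Atom) :
    Definable (Agent := Agent) C fun (_ : Type w) M s => s ∈ M.val p :=
  ⟨.atom p, trivial, fun _ _ _ => Iff.rfl⟩

theorem not (h : Definable C P) : Definable C fun S M s => ¬ P S M s := by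
  obtain ⟨ψ, h1, h2⟩ := h
  exact ⟨.neg ψ, h1, fun S M s => not_congr (h2 S M s)⟩

theorem and (h : Definable C P) (h' : Definable C P') :
    Definable C fun S M s => P S M s ∧ P' S M s := by
  obtain ⟨ψ, h1, h2⟩ := h
  obtain ⟨ψ', h1', h2'⟩ := h'
  exact ⟨.and ψ ψ', ⟨h1, h1'⟩, fun S M s => and_congr (h2 S M s) (h2' S M s)⟩

theorem box (a : Agent) (h : Definable C P) :
    Definable C fun S M s => ∀ t, M.rel a s t → P S M t := by
  obtain ⟨ψ, h1, h2⟩ := h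
  exact ⟨.box a ψ, h1, fun S M s => forall_congr' fun t => imp_congr_right fun _ => h2 S M t⟩

theorem true [Nonempty Atom] :
    Definable (Atom := Atom) (Agent := Agent) C fun (_ : Type w) _ _ => True := by
  obtain ⟨p⟩ := ‹Nonempty Atom›
  exact ((atom p).and (atom p).not).not.congr fun _ _ _ => by simp

theorem imp (h : Definable C P) (h' : Definable C P') :
    Definable C fun S M s => P S M s → P' S M s :=
  (h.and h'.not).not.congr fun _ _ _ => by simp

theorem iff (h : Definable C P) (h' : Definable C P') :
    Definable C fun S M s => P S M s ↔ P' S M s :=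
  ((h.imp h').and (h'.imp h)).congr fun _ _ _ => iff_def.symm

theorem const [Nonempty Atom] (c : Prop) :
    Definable (Atom := Atom) (Agent := Agent) C fun (_ : Type w) _ _ => c := by
  by_cases hc : c
  · exact true.congr fun _ _ _ => by simp [hc]
  · exact true.not.congr fun _ _ _ => by simp [hc]

theorem all [Nonempty Atom] {ι : Type*} [Finite ι]
    {R : ι → ∀ S : Type w, KripkeModel Atom Agent S → S → Prop} (h : ∀ i, Definable C (R i)) :
    Definable C fun S M s => ∀ i, R i S M s := by
  have key : ∀ F : Set ι, F.Finite → Definable C fun S M s => ∀ i ∈ F, R i S M s := by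
    intro F hF
    induction F, hF using Set.Finite.induction_on with
    | empty => exact true.congr fun _ _ _ => by simp
    | @insert i _ _ _ ih => exact ((h i).and ih).congr fun _ _ _ => by simp
  exact (key Set.univ Set.finite_univ).congr fun _ _ _ => by simp

theorem typ_eq [Nonempty Atom] [Finite Agent] {Q : Set Atom} (hQ : Q.Finite) :
    ∀ (k : ℕ) (τ : Ty Agent Q k), Definable C fun (_ : Type w) M s => typ Q k M s = τ
  | 0, _ => true.congr fun _ _ _ => ⟨fun _ => rfl, fun _ => trivial⟩
  | k + 1, τ => by
    have := Ty.finite (Agent := Agent) hQ k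
    have := hQ.to_subtype
    have h1 : Definable C fun (S : Type w) (M : KripkeModel Atom Agent S) s =>
        ∀ p : Q, s ∈ M.val p ↔ p ∈ τ.1 := all fun p => (atom p.1).iff (const _)
    have h2 : Definable C fun (S : Type w) (M : KripkeModel Atom Agent S) s =>
        ∀ (a : Agent) (σ : Ty Agent Q k),
          (¬ ∀ t, M.rel a s t → ¬ typ Q k M t = σ) ↔ σ ∈ τ.2 a :=
      all fun a => all fun σ => ((typ_eq hQ k σ).not.box a).not.iff (const _)
    refine (h1.and h2).congr fun S M s => ⟨fun ⟨h1, h2⟩ => ?_, ?_⟩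
    · refine Prod.ext (Set.ext h1) (funext fun a => Set.ext fun σ => ?_)
      rw [← h2 a σ]
      push Not
      exact Iff.rfl
    · rintro rfl
      refine ⟨fun p => Iff.rfl, fun a σ => ?_⟩
      push Not
      exact Iff.rfl

/-- Properties that depend only on the type of some finite depth are definable. -/
theorem of_invariant [Nonempty Atom] [Finite Agent] {Q : Set Atom} (hQ : Q.Finite) (k : ℕ)
    (h : ∀ (S S' : Type w) (M : KripkeModel Atom Agent S) (M' : KripkeModel Atom Agent S')
      (s : S) (s' : S'), typ Q k M s = typ Q k M' s' → P S M s → P S' M' s') :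
    Definable C P := by
  have := Ty.finite (Agent := Agent) hQ k
  -- A finite conjunction over `τ`; the conclusion of each implication does not depend on the state,
  -- so it is a constant.
  have h1 : Definable C fun (S : Type w) (M : KripkeModel Atom Agent S) s =>
      ∀ τ : Ty Agent Q k, typ Q k M s = τ →
        ∃ (S' : Type w) (M' : KripkeModel Atom Agent S') (s' : S'), typ Q k M' s' = τ ∧ P S' M' s' :=
    all fun τ => (typ_eq hQ k τ).imp (const _)
  refine h1.congr fun S M s => ⟨fun h2 => ?_, fun h2 τ hτ => ⟨S, M, s, hτ, h2⟩⟩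
  obtain ⟨S', M', s', h3, h4⟩ := h2 _ rfl
  exact h S' S M' M s' s h3 h4

end Definable

/-! ### Frames -/

theorem FrameClass.Frame.rel_iff {C : FrameClass} {Agent : Type v} {S : Type w}
    {R : Agent → S → S → Prop} (h : C.Frame R) (hC : C ≠ .K) {a : Agent} {x y : S}
    (hxy : R a x y) (z : S) : R a x z ↔ R a y z := by
  cases C with
  | K => exact absurd rfl hC
  | K45 => exact ⟨(h a).2 x y z hxy, (h a).1 x y z hxy⟩
  | S5 => exact ⟨(h a).2.2 x y z hxy, (h a).2.1 x y z hxy⟩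

theorem succTyp_eq_of_rel {Atom : Type u} {Agent : Type v} {S : Type w} {C : FrameClass}
    {M : KripkeModel Atom Agent S} (h : C.Frame M.rel) (hC : C ≠ .K) {a : Agent} {s t : S}
    (hst : M.rel a s t) (Q : Set Atom) (k : ℕ) : succTyp Q k a M s = succTyp Q k a M t := by
  ext τ
  simp only [succTyp, Set.mem_ofPred_eq, h.rel_iff hC hst]

section Update

variable {Atom : Type u} {Agent : Type v} {S : Type w} {P : Type} {C : FrameClass}
  {M : KripkeModel Atom Agent S} {rel : Agent → P → P → Prop} {h : S → P → Prop}

theorem KripkeModel.InClass.update (hM : M.InClass C) (hrel : C.Frame rel) {s : S} {t : P}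
    (hst : h s t) : (M.update rel h).InClass C := by
  refine ⟨⟨⟨(s, t), hst⟩⟩, ?_⟩
  have hf := hM.2
  cases C with
  | K => trivial
  | K45 =>
    exact fun a => ⟨fun x y z h1 h2 => ⟨(hf a).1 _ _ _ h1.1 h2.1, (hrel a).1 _ _ _ h1.2 h2.2⟩,
      fun x y z h1 h2 => ⟨(hf a).2 _ _ _ h1.1 h2.1, (hrel a).2 _ _ _ h1.2 h2.2⟩⟩
  | S5 =>
    exact fun a => ⟨fun x => ⟨(hf a).1 _, (hrel a).1 _⟩,
      fun x y z h1 h2 => ⟨(hf a).2.1 _ _ _ h1.1 h2.1, (hrel a).2.1 _ _ _ h1.2 h2.2⟩,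
      fun x y z h1 h2 => ⟨(hf a).2.2 _ _ _ h1.1 h2.1, (hrel a).2.2 _ _ _ h1.2 h2.2⟩⟩

theorem refines_update {s : S} {t : P} (hst : h s t) :
    Refines (M.update rel h) ⟨(s, t), hst⟩ M s :=
  ⟨fun x y => x.1.1 = y, fun _ _ e _ => e ▸ Iff.rfl,
    fun _ _ e _ y hy => ⟨y.1.1, e ▸ hy.1, rfl⟩, rfl⟩

/-- Updates with preconditions of depth `m` turn equality of types of depth `m + k` into
equality of types of depth `k`. -/
theorem typ_update_eq {S' : Type w} {M' : KripkeModel Atom Agent S'} {h' : S' → P → Prop}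
    {Q : Set Atom} {m : ℕ}
    (hh : ∀ s s', typ Q m M s = typ Q m M' s' → ∀ t, h s t ↔ h' s' t) (k : ℕ) {s : S} {s' : S'}
    {t : P} (hst : h s t) (hst' : h' s' t) (e : typ Q (m + k) M s = typ Q (m + k) M' s') :
    typ Q k (M.update rel h) ⟨(s, t), hst⟩ = typ Q k (M'.update rel h') ⟨(s', t), hst'⟩ := by
  induction k generalizing s s' t with
  | zero => rfl
  | succ k ih =>
    rw [← add_assoc, typ_succ_eq_iff] at e
    rw [typ_succ_eq_iff]
    refine ⟨e.1, fun a => ⟨?_, ?_⟩⟩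
    · rintro ⟨⟨u, y⟩, hu⟩ hr
      obtain ⟨u', h1, h2⟩ := (e.2 a).1 u hr.1
      have hu' := (hh u u' (typ_eq_of_le (Nat.le_add_right _ _) h2) y).mp hu
      exact ⟨⟨(u', y), hu'⟩, ⟨h1, hr.2⟩, ih hu hu' h2⟩
    · rintro ⟨⟨u', y⟩, hu'⟩ hr
      obtain ⟨u, h1, h2⟩ := (e.2 a).2 u' hr.1
      have hu := (hh u u' (typ_eq_of_le (Nat.le_add_right _ _) h2) y).mpr hu'
      exact ⟨⟨(u, y), hu⟩, ⟨h1, hr.2⟩, ih hu hu' h2⟩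

end Update

/-! ### Paths of types -/

section Paths

variable {Atom : Type u} {Agent : Type v} {I J : Type}

open Classical in
/-- The path at which the `b`-cluster of a path is attached. -/
noncomputable def base (C : FrameClass) (e : Agent ≃ I) (b : Agent) : List (I × J) → List (I × J)
  | [] => []
  -- Outside K, points joined by a `b`-edge have the same `b`-successors, so a final `b`-step is
  -- dropped before another is taken.
  | c :: l => if C ≠ .K ∧ c.1 = e b then l else c :: l

/-- The accessibility relations between paths. -/
def PathRel (C : FrameClass) (e : Agent ≃ I) (b : Agent) (x y : List (I × J)) : Prop :=
  -- In K45 the base sees its cluster without belonging to it; the second disjunct puts it inside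
  -- for S5.
  (∃ j, y = (e b, j) :: base C e b x) ∨ (C = .S5 ∧ base C e b x = base C e b y)

variable {C : FrameClass} {e : Agent ≃ I} {b : Agent}

theorem base_cases (x : List (I × J)) :
    base C e b x = x ∨ C ≠ .K ∧ ∃ j, x = (e b, j) :: base C e b x := by
  match x with
  | [] => exact Or.inl rfl
  | (i, j) :: l =>
    by_cases h : C ≠ .K ∧ i = e b
    · refine Or.inr ⟨h.1, j, ?_⟩
      rw [base, if_pos h, h.2]
    · exact Or.inl (if_neg h)

theorem base_cons (hC : C ≠ .K) (j : J) (l : List (I × J)) : base C e b ((e b, j) :: l) = l :=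
  if_pos ⟨hC, rfl⟩

theorem frame_pathRel (p : List (I × J) → Prop) :
    C.Frame fun b (x y : {x // p x}) => PathRel C e b x.1 y.1 := by
  cases C with
  | K => trivial
  | K45 =>
    intro b
    have key : ∀ x y : List (I × J), PathRel .K45 e b x y →
        base .K45 e b y = base .K45 e b x := by
      rintro x y (⟨j, rfl⟩ | ⟨h, _⟩)
      · exact base_cons (by simp) _ _
      · cases h
    refine ⟨fun x y z hxy hyz => ?_, fun x y z hxy hxz => ?_⟩
    · simpa only [PathRel, key _ _ hxy] using hyz
    · simpa only [PathRel, key _ _ hxy] using hxz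
  | S5 =>
    intro b
    have key : ∀ x y : List (I × J), PathRel .S5 e b x y ↔
        base .S5 e b x = base .S5 e b y := by
      refine fun x y => ⟨?_, fun h => Or.inr ⟨rfl, h⟩⟩
      rintro (⟨j, rfl⟩ | ⟨_, h⟩)
      · exact (base_cons (by simp) _ _).symm
      · exact h
    simp only [key]
    exact ⟨fun _ => trivial, fun _ _ _ h1 h2 => h1.trans h2, fun _ _ _ h1 h2 => h1.symm.trans h2⟩

variable {S' : Type w}

/-- The state that represents the type at the end of a path. -/
def label (s' : S') (f : J → S') : List (I × J) → S'
  | [] => s'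
  | c :: _ => f c.2

/-- The state ends a chain of states that starts at `s'` and has the types given by the path. -/
def Realizes (e : Agent ≃ I) (M' : KripkeModel Atom Agent S') (s' : S') (f : J → S')
    (Q : Set Atom) (n : ℕ) : List (I × J) → S' → Prop
  | [], t => t = s'
  | c :: l, t => ∃ r, Realizes e M' s' f Q n l r ∧ M'.rel (e.symm c.1) r t ∧
      typ Q (n - (l.length + 1)) M' t = typ Q (n - (l.length + 1)) M' (f c.2)

variable {M' : KripkeModel Atom Agent S'} {s' : S'} {f : J → S'} {Q : Set Atom} {n : ℕ}

theorem Realizes.typ_eq {x : List (I × J)} {t : S'} (h : Realizes e M' s' f Q n x t) :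
    typ Q (n - x.length) M' t = typ Q (n - x.length) M' (label s' f x) := by
  match x, h with
  | [], h => rw [show t = s' from h]; rfl
  | c :: l, ⟨_, _, _, h⟩ => exact h

theorem Realizes.succTyp_eq {x : List (I × J)} {t r : S'} {k : ℕ}
    (ht : Realizes e M' s' f Q n x t) (hr : Realizes e M' s' f Q n x r)
    (hk : n - x.length = k + 1) (a : Agent) : succTyp Q k a M' t = succTyp Q k a M' r := by
  have h := ht.typ_eq.trans hr.typ_eq.symm
  rw [hk] at h
  exact succTyp_eq_of_typ_eq h a

theorem realizes_cons {j : J} {l : List (I × J)} {t : S'} :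
    Realizes e M' s' f Q n ((e b, j) :: l) t ↔
      ∃ r, Realizes e M' s' f Q n l r ∧ M'.rel b r t ∧
        typ Q (n - (l.length + 1)) M' t = typ Q (n - (l.length + 1)) M' (f j) := by
  simp only [Realizes, Equiv.symm_apply_apply]

/-- States realizing the same path have equal types with at least one level left, so a child
realized after one is realized after all. If `x` itself ends in a `b`-step, argue at the predecessor
of `t`, which has the same `b`-successors as `t`. -/
theorem Realizes.exists_rel_cons (hM' : C.Frame M'.rel) {x : List (I × J)} {j : J} {t r : S'}
    (ht : Realizes e M' s' f Q n x t) (hr : Realizes e M' s' f Q n ((e b, j) :: base C e b x) r)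
    (hn : (base C e b x).length + 1 ≤ n) :
    ∃ u, M'.rel b t u ∧ Realizes e M' s' f Q n ((e b, j) :: base C e b x) u := by
  obtain ⟨q, hq, hqr, hrj⟩ := realizes_cons.mp hr
  have hk : n - (base C e b x).length = n - ((base C e b x).length + 1) + 1 := by omega
  have key : ∀ t', Realizes e M' s' f Q n (base C e b x) t' →
      ∃ u, M'.rel b t' u ∧ Realizes e M' s' f Q n ((e b, j) :: base C e b x) u := by
    intro t' ht'
    obtain ⟨u, h1, h2⟩ := exists_rel_of_succTyp_eq (hq.succTyp_eq ht' hk b) hqr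
    exact ⟨u, h1, realizes_cons.mpr ⟨t', ht', h1, h2.trans hrj⟩⟩
  rcases base_cases (C := C) (e := e) (b := b) x with h | ⟨hC, j', h⟩
  · exact key t (h.symm ▸ ht)
  · rw [h] at ht
    obtain ⟨q', hq', hqt, -⟩ := realizes_cons.mp ht
    obtain ⟨u, h1, h2⟩ := key q' hq'
    exact ⟨u, (hM'.rel_iff hC hqt u).mp h1, h2⟩

theorem Realizes.exists_rel (hM' : C.Frame M'.rel) {x y : List (I × J)} {t r : S'}
    (ht : Realizes e M' s' f Q n x t) (hr : Realizes e M' s' f Q n y r) (hy : y.length ≤ n)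
    (hxy : PathRel C e b x y) : ∃ u, M'.rel b t u ∧ Realizes e M' s' f Q n y u := by
  rcases hxy with ⟨j, rfl⟩ | ⟨rfl, h⟩
  · exact ht.exists_rel_cons hM' hr hy
  · rcases base_cases (C := .S5) (e := e) (b := b) y with h' | ⟨-, j, h'⟩
    · rw [h'] at h
      rcases base_cases (C := .S5) (e := e) (b := b) x with h2 | ⟨hC, j', h2⟩
      · rw [h2] at h
        exact ⟨t, (hM' b).1 t, h ▸ ht⟩
      · rw [h2] at ht
        obtain ⟨q, hq, hqt, -⟩ := realizes_cons.mp ht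
        -- Symmetry in S5 leads from `t` back to its predecessor.
        exact ⟨q, (hM' b).2.2 _ _ _ hqt ((hM' b).1 q), h ▸ hq⟩
    · rw [h', ← h] at hr hy ⊢
      exact ht.exists_rel_cons hM' hr hy

theorem Realizes.exists_cons (hM' : C.Frame M'.rel)
    (hf : ∀ t, ∃ j, typ Q n M' t = typ Q n M' (f j)) {x : List (I × J)} {t u : S'}
    (ht : Realizes e M' s' f Q n x t) (htu : M'.rel b t u) :
    ∃ j, Realizes e M' s' f Q n ((e b, j) :: base C e b x) u := by
  obtain ⟨j, hj⟩ := hf u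
  refine ⟨j, realizes_cons.mpr ?_⟩
  rcases base_cases (C := C) (e := e) (b := b) x with h | ⟨hC, j', h⟩
  · exact ⟨t, h.symm ▸ ht, htu, typ_eq_of_le (Nat.sub_le _ _) hj⟩
  · rw [h] at ht
    obtain ⟨q, hq, hqt, -⟩ := realizes_cons.mp ht
    exact ⟨q, hq, (hM'.rel_iff hC hqt u).mpr htu, typ_eq_of_le (Nat.sub_le _ _) hj⟩

theorem length_le_of_pathRel {x y : List (I × J)} (h : PathRel C e b x y) :
    y.length ≤ x.length + 1 := by
  have hb : ∀ z : List (I × J), (base C e b z).length ≤ z.length ∧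
      z.length ≤ (base C e b z).length + 1 := by
    intro z
    rcases base_cases (C := C) (e := e) (b := b) z with h | ⟨-, j, h⟩
    · rw [h]; omega
    · have := congrArg List.length h
      rw [List.length_cons] at this
      omega
  rcases h with ⟨j, rfl⟩ | ⟨-, h⟩
  · have := (hb x).1
    rw [List.length_cons]
    omega
  · have h1 := (hb x).1
    have h2 := (hb y).2
    rw [← h] at h2
    omega

/-- The realized paths of length at most `n`. -/
abbrev Path (e : Agent ≃ I) (M' : KripkeModel Atom Agent S') (s' : S') (f : J → S')
    (Q : Set Atom) (n : ℕ) : Type :=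
  {x : List (I × J) // x.length ≤ n ∧ ∃ t, Realizes e M' s' f Q n x t}

/-- In a product with the paths, the states have the types that the paths prescribe. -/
theorem typ_update_path (hM' : C.Frame M'.rel)
    (hf : ∀ t, ∃ j, typ Q n M' t = typ Q n M' (f j)) {S : Type w} {M : KripkeModel Atom Agent S}
    {h : S → Path e M' s' f Q n → Prop}
    (hval : ∀ t x, h t x → x.1.length < n → ∀ p ∈ Q, t ∈ M.val p ↔ label s' f x.1 ∈ M'.val p)
    (hstep : ∀ t x, h t x → ∀ b j y, y.1 = (e b, j) :: base C e b x.1 →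
      ∃ u, M.rel b t u ∧ h u y)
    (k : ℕ) {t : S} {x : Path e M' s' f Q n} (hk : x.1.length + k ≤ n) (htx : h t x) :
    typ Q k (M.update (fun b x y => PathRel C e b x.1 y.1) h) ⟨(t, x), htx⟩ =
      typ Q k M' (label s' f x.1) := by
  induction k generalizing t x with
  | zero => rfl
  | succ k ih =>
    obtain ⟨x', hx'⟩ := x.2.2
    have hxx' : typ Q (k + 1) M' (label s' f x.1) = typ Q (k + 1) M' x' :=
      typ_eq_of_le (by omega) hx'.typ_eq.symm
    have hlab : ∀ {y : Path e M' s' f Q n} {u'}, y.1.length ≤ x.1.length + 1 →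
        Realizes e M' s' f Q n y.1 u' → typ Q k M' (label s' f y.1) = typ Q k M' u' :=
      fun hy hu' => typ_eq_of_le (by omega) hu'.typ_eq.symm
    have hval' := hval t x htx (by omega)
    -- Compare with a realizing state `x'` instead of the label: its successors continue the
    -- realized path.
    refine Eq.trans ?_ hxx'.symm
    rw [typ_succ_eq_iff] at hxx' ⊢
    refine ⟨fun p hp => (hval' p hp).trans (hxx'.1 p hp), fun b => ⟨?_, fun u' hu' => ?_⟩⟩
    · rintro ⟨⟨u, y⟩, hu⟩ hr
      obtain ⟨y', hy'⟩ := y.2.2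
      have hlen : y.1.length ≤ x.1.length + 1 := length_le_of_pathRel hr.2
      obtain ⟨u', h1, h2⟩ := hx'.exists_rel hM' hy' y.2.1 hr.2
      exact ⟨u', h1, (ih (x := y) (by omega) hu).trans (hlab hlen h2)⟩
    -- Every successor of `x'` realizes a child of the base, so `hstep` is needed for such paths
    -- only.
    · obtain ⟨j, hj⟩ := hx'.exists_cons (C := C) hM' hf hu'
      have hrel : PathRel C e b x.1 ((e b, j) :: base C e b x.1) := Or.inl ⟨j, rfl⟩
      have hlen := length_le_of_pathRel hrel
      let y : Path e M' s' f Q n := ⟨_, by omega, u', hj⟩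
      obtain ⟨u, h1, h2⟩ := hstep t x htx b j y rfl
      exact ⟨⟨(u, y), h2⟩, ⟨h1, hrel⟩,
        (ih (x := y) (by simp only [y]; omega) h2).trans (hlab (y := y) hlen hj)⟩

end Paths

/-! ### Synthesis -/

section Synthesis

variable {Atom : Type u} {Agent : Type v} {I J : Type} {S S' : Type w}

/-- The state `t` looks, as far as the path `x` can tell, like a state of `M` that simulates a
state realizing the path. -/
def Simulable (C : FrameClass) (e : Agent ≃ I) (M' : KripkeModel Atom Agent S') (s' : S')
    (f : J → S') (Q : Set Atom) (n : ℕ) (M : KripkeModel Atom Agent S) (Z : S' → S → Prop)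
    (x : List (I × J)) {T : Type w} (N : KripkeModel Atom Agent T) (t : T) : Prop :=
  ∃ x' r, Realizes e M' s' f Q n x x' ∧ Z x' r ∧
    typ Q (n - x.length) M r = typ Q (n - x.length) N t ∧
    -- One level more than the type gives: a further `a`-step stays in the cluster and leaves the
    -- length of the path unchanged, so no depth may be lost.
    (C ≠ .K → ∀ a j l, x = (e a, j) :: l →
      succTyp Q (n - x.length) a M r = succTyp Q (n - x.length) a N t)

variable {C : FrameClass} {e : Agent ≃ I} {M' : KripkeModel Atom Agent S'} {s' : S'}
  {f : J → S'} {Q : Set Atom} {n : ℕ} {M : KripkeModel Atom Agent S} {Z : S' → S → Prop}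

theorem Simulable.congr {x : List (I × J)} {T T' : Type w} {N : KripkeModel Atom Agent T}
    {N' : KripkeModel Atom Agent T'} {t : T} {t' : T'}
    (h : typ Q (n - x.length + 1) N t = typ Q (n - x.length + 1) N' t')
    (hs : Simulable C e M' s' f Q n M Z x N t) : Simulable C e M' s' f Q n M Z x N' t' := by
  obtain ⟨x', r, h1, h2, h3, h4⟩ := hs
  exact ⟨x', r, h1, h2, h3.trans (typ_eq_of_typ_succ_eq h),
    fun hC a j l hx => (h4 hC a j l hx).trans (succTyp_eq_of_typ_eq h a)⟩

/-- The step is taken in `M'`, carried to `M` by the simulation, then to `N` by equality of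
successor types. Outside K the extra clause of `Simulable` survives because successor types are
constant along an edge. -/
theorem Simulable.exists_rel (hM : C.Frame M.rel) (hM' : C.Frame M'.rel)
    (hZ : ∀ x x', Z x x' → ∀ a y, M'.rel a x y → ∃ y', M.rel a x' y' ∧ Z y y')
    {x : List (I × J)} {T : Type w} {N : KripkeModel Atom Agent T} (hN : C.Frame N.rel) {t : T}
    (hs : Simulable C e M' s' f Q n M Z x N t) {b : Agent} {j : J}
    (hn : (base C e b x).length + 1 ≤ n)
    (hy : ∃ r, Realizes e M' s' f Q n ((e b, j) :: base C e b x) r) :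
    ∃ u, N.rel b t u ∧ Simulable C e M' s' f Q n M Z ((e b, j) :: base C e b x) N u := by
  obtain ⟨x', r, hx', hr, h3, h4⟩ := hs
  obtain ⟨y', hy'⟩ := hy
  obtain ⟨u', hu', hyu'⟩ := hx'.exists_rel_cons hM' hy' hn
  obtain ⟨v, hv, hZv⟩ := hZ x' r hr b u' hu'
  have hsucc : succTyp Q (n - ((base C e b x).length + 1)) b M r =
      succTyp Q (n - ((base C e b x).length + 1)) b N t := by
    rcases base_cases (C := C) (e := e) (b := b) x with h | ⟨hC, j', h⟩
    · rw [h] at hn ⊢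
      have hk : n - x.length = n - (x.length + 1) + 1 := by omega
      rw [hk] at h3
      exact succTyp_eq_of_typ_eq h3 b
    · have := h4 hC b j' _ h
      rwa [show x.length = (base C e b x).length + 1 from congrArg List.length h] at this
  obtain ⟨u, hu, hvu⟩ := exists_rel_of_succTyp_eq hsucc hv
  refine ⟨u, hu, u', v, hyu', hZv, hvu.symm, fun hC a j' l hl => ?_⟩
  obtain rfl : b = a := e.injective (congrArg Prod.fst (List.cons.inj hl).1)
  rw [List.length_cons, ← succTyp_eq_of_rel hM hC hv, ← succTyp_eq_of_rel hN hC hu, hsucc]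

/-- For every refinement of a pointed model there is a finite action model that produces, on all
pointed models of the same type of depth `n`, the type of depth `n` of the refinement. -/
theorem exists_actionModel_typ_eq [Nonempty Atom] [Finite Agent] (hQ : Q.Finite) (n : ℕ)
    (hM : C.Frame M.rel) (hM' : C.Frame M'.rel) {s : S} (href : Refines M' s' M s) :
    ∃ (A : ActionModel Agent (Form Atom Agent)) (x : A.Point), A.InClass C ∧
      (∀ y, (A.pre y).InLang C) ∧
      ∀ (T : Type w) (N : KripkeModel Atom Agent T) (t : T), C.Frame N.rel →
        typ Q n M s = typ Q n N t → ∃ h : Sat C (A.pre x) N t,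
          typ Q n (N.update A.rel fun t y => Sat C (A.pre y) N t) ⟨(t, x), h⟩ =
            typ Q n M' s' := by
  obtain ⟨Z, hval, hZ, hs⟩ := href
  have := Ty.finite (Agent := Agent) hQ n
  -- Action points must live in `Type`, so agents and realized types are numbered.
  obtain ⟨k, ⟨e⟩⟩ := Finite.exists_equiv_fin Agent
  obtain ⟨m, ⟨g⟩⟩ := Finite.exists_equiv_fin (Set.range fun t => typ Q n M' t)
  let f : Fin m → S' := fun j => (g.symm j).2.choose
  have hf : ∀ t, ∃ j, typ Q n M' t = typ Q n M' (f j) := fun t => by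
    refine ⟨g ⟨_, t, rfl⟩, ?_⟩
    have := (g.symm (g ⟨_, t, rfl⟩)).2.choose_spec
    exact (this.trans (by rw [Equiv.symm_apply_apply])).symm
  have hdef : ∀ x : List (Fin k × Fin m), Definable C fun (T : Type w) N (t : T) =>
      Simulable C e M' s' f Q n M Z x N t := fun x =>
    Definable.of_invariant hQ (n - x.length + 1) fun _ _ _ _ _ _ h => Simulable.congr h
  choose pre hpre hsat using hdef
  have hroot : Realizes e M' s' f Q n [] s' := rfl
  let A : ActionModel Agent (Form Atom Agent) :=
    { Point := Path e M' s' f Q n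
      finite := Set.Finite.subset (List.finite_length_le (Fin k × Fin m) n) fun _ h => h.1
      nonempty := ⟨⟨[], Nat.zero_le n, s', hroot⟩⟩
      rel := fun b x y => PathRel C e b x.1 y.1
      pre := fun x => pre x.1 }
  refine ⟨A, ⟨[], Nat.zero_le n, s', hroot⟩, frame_pathRel _, fun y => hpre y.1,
    fun T N t hN hst => ⟨(hsat _ T N t).mpr ⟨s', s, hroot, hs, hst, by simp⟩, ?_⟩⟩
  refine typ_update_path (x := ⟨[], Nat.zero_le n, s', hroot⟩) hM' hf ?_ ?_ n (by simp) _
  · intro t x htx hx p hp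
    obtain ⟨x', r, hx', hr, h3, -⟩ := (hsat _ T N t).mp htx
    have h1 := hx'.typ_eq
    obtain ⟨d, hd⟩ : ∃ d, n - x.1.length = d + 1 := ⟨n - x.1.length - 1, by omega⟩
    rw [hd, typ_succ_eq_iff] at h1 h3
    exact (h3.1 p hp).symm.trans ((hval x' r hr p).symm.trans (h1.1 p hp))
  · intro t x htx b j y hy
    have hyl := y.2.1
    have hyr := y.2.2
    rw [hy] at hyl hyr
    obtain ⟨u, h1, h2⟩ := ((hsat _ T N t).mp htx).exists_rel hM hM' hZ hN hyl hyr
    exact ⟨u, h1, (hsat _ T N u).mpr (hy ▸ h2)⟩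

end Synthesis

/-! ### Invariance of all formulas -/

/-- The truth of the formula on the class `C` is preserved by equality of types. -/
def Form.Invariant {Atom : Type u} {Agent : Type v} (C : FrameClass) (Q : Set Atom) (n : ℕ)
    (φ : Form Atom Agent) : Prop :=
  ∀ (S S' : Type w) (M : KripkeModel Atom Agent S) (M' : KripkeModel Atom Agent S')
    (s : S) (s' : S'), M.InClass C → M'.InClass C → typ Q n M s = typ Q n M' s' →
      Sat C φ M s → Sat C φ M' s'

section Invariance

variable {Atom : Type u} {Agent : Type v} {C : FrameClass} {Q : Set Atom} {n : ℕ}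
  {φ : Form Atom Agent}

theorem Form.Invariant.mono (h : Form.Invariant.{u, v, w} C Q n φ) {Q' : Set Atom} {m : ℕ}
    (hQ : Q ⊆ Q') (hn : n ≤ m) : Form.Invariant.{u, v, w} C Q' m φ :=
  fun S S' M M' s s' hM hM' he => h S S' M M' s s' hM hM' (typ_eq_of_subset hQ (typ_eq_of_le hn he))

/-- Synthesize a given refinement of the second model and run the action model on the first: the
result refines the first model and has the type of the given refinement. Hence the depth does not
grow. -/
theorem Form.Invariant.allRef [Nonempty Atom] [Finite Agent] (hQ : Q.Finite)
    (h : Form.Invariant.{u, v, w} C Q n φ) : Form.Invariant.{u, v, w} C Q n φ.allRef := by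
  intro S S' M M' s s' hM hM' he hs T N t hN href
  obtain ⟨A, x, hA, -, hx⟩ := exists_actionModel_typ_eq hQ n hM'.2 hN.2 href
  obtain ⟨h1, h2⟩ := hx S M s hM.2 he.symm
  have hU := hM.update (h := fun t y => Sat C (A.pre y) M t) hA h1
  exact h _ _ _ _ _ _ hU hN h2 (hs _ _ _ hU (refines_update h1))

theorem Form.Invariant.act {P : Type} {finite : Finite P} {nonempty : Nonempty P}
    {rel : Agent → P → P → Prop} {pre : P → Form Atom Agent} {T : Set P} {m : ℕ}
    (hrel : C.Frame rel) (hpre : ∀ t, Form.Invariant.{u, v, w} C Q m (pre t))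
    (h : Form.Invariant.{u, v, w} C Q n φ) :
    Form.Invariant.{u, v, w} C Q (m + n) (.act P finite nonempty rel pre T φ) := by
  intro S S' M M' s s' hM hM' he hs _ t ht hst'
  have hh : ∀ r r', typ Q m M r = typ Q m M' r' → ∀ t, Sat C (pre t) M r ↔ Sat C (pre t) M' r' :=
    fun r r' hr t =>
      ⟨hpre t _ _ _ _ _ _ hM hM' hr, hpre t _ _ _ _ _ _ hM' hM hr.symm⟩
  have hst := (hh s s' (typ_eq_of_le (Nat.le_add_right _ _) he) t).mpr hst'
  -- The state `(s, t)` makes the product non-empty, so the proviso of the action modality holds.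
  have hU : (M.update rel fun x t => Sat C (pre t) M x).InClass C := hM.update hrel hst
  have hU' : (M'.update rel fun x t => Sat C (pre t) M' x).InClass C := hM'.update hrel hst'
  exact h _ _ _ _ _ _ hU hU' (typ_update_eq hh n hst hst' he) (hs hU t ht hst)

theorem Form.exists_invariant [Nonempty Atom] [Finite Agent] (φ : Form Atom Agent)
    (hφ : φ.InLang C) : ∃ (Q : Set Atom) (n : ℕ), Q.Finite ∧ Form.Invariant.{u, v, w} C Q n φ := by
  induction φ with
  | atom p =>
    refine ⟨{p}, 1, Set.finite_singleton p, fun S S' M M' s s' _ _ he hs => ?_⟩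
    exact ((typ_succ_eq_iff.mp he).1 p rfl).mp hs
  | neg φ ih =>
    obtain ⟨Q, n, hQ, h⟩ := ih hφ
    exact ⟨Q, n, hQ, fun S S' M M' s s' hM hM' he hs hs' =>
      hs (h _ _ _ _ _ _ hM' hM he.symm hs')⟩
  | and φ ψ ih₁ ih₂ =>
    obtain ⟨Q₁, n₁, hQ₁, h₁⟩ := ih₁ hφ.1
    obtain ⟨Q₂, n₂, hQ₂, h₂⟩ := ih₂ hφ.2
    refine ⟨Q₁ ∪ Q₂, max n₁ n₂, hQ₁.union hQ₂, fun S S' M M' s s' hM hM' he hs => ⟨?_, ?_⟩⟩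
    · exact h₁.mono Set.subset_union_left (le_max_left _ _) _ _ _ _ _ _ hM hM' he hs.1
    · exact h₂.mono Set.subset_union_right (le_max_right _ _) _ _ _ _ _ _ hM hM' he hs.2
  | box a φ ih =>
    obtain ⟨Q, n, hQ, h⟩ := ih hφ
    refine ⟨Q, n + 1, hQ, fun S S' M M' s s' hM hM' he hs t' ht' => ?_⟩
    obtain ⟨t, ht, he'⟩ := ((typ_succ_eq_iff.mp he).2 a).2 t' ht'
    exact h _ _ _ _ _ _ hM hM' he' (hs t ht)
  | act P finite nonempty rel pre T φ ih₁ ih₂ =>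
    obtain ⟨Q, n, hQ, h⟩ := ih₂ hφ.2.2
    choose Q' n' hQ' h' using fun t => ih₁ t (hφ.2.1 t)
    obtain ⟨m, hm⟩ := (Set.finite_range n').bddAbove
    refine ⟨Q ∪ ⋃ t, Q' t, m + n, hQ.union (Set.finite_iUnion hQ'),
      Form.Invariant.act hφ.1 (fun t => ?_) (h.mono Set.subset_union_left le_rfl)⟩
    exact (h' t).mono ((Set.subset_iUnion Q' t).trans Set.subset_union_right) (hm ⟨t, rfl⟩)
  | allRef φ ih =>
    obtain ⟨Q, n, hQ, h⟩ := ih hφ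
    exact ⟨Q, n, hQ, h.allRef hQ⟩

end Invariance

end AAML

theorem mainTheorem12 {Atom : Type u} {Agent : Type v} [Nonempty Atom] [Countable Atom]
    [Nonempty Agent] [Finite Agent] (C : AAML.FrameClass) {S : Type w}
    (M : AAML.KripkeModel Atom Agent S) (hM : M.InClass C) (s : S)
    (φ : AAML.Form Atom Agent) (hφ : φ.InLang C) :
    AAML.Sat C φ.someRef M s ↔
      ∃ (A : AAML.ActionModel Agent (AAML.Form Atom Agent)) (a : A.Point),
        A.InClass C ∧ (∀ t, (A.pre t).InLang C) ∧
          AAML.Sat C (AAML.Form.diaAct A {a} φ) M s := by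
  constructor
  · intro h
    by_contra hno
    refine h fun S' M' s' hM' href hs' => hno ?_
    obtain ⟨Q, n, hQ, hinv⟩ := φ.exists_invariant hφ
    obtain ⟨A, x, hA, hpre, hx⟩ := AAML.exists_actionModel_typ_eq hQ n hM.2 hM'.2 href
    obtain ⟨h1, h2⟩ := hx S M s hM.2 rfl
    have hU := hM.update (h := fun t y => AAML.Sat C (A.pre y) M t) hA h1
    exact ⟨A, x, hA, hpre, fun hbox =>
      hbox hU x rfl h1 (hinv _ _ _ _ _ _ hM' hU h2.symm hs')⟩
  · rintro ⟨A, a, hA, -, h⟩ hall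
    -- Membership of the product in the class is the proviso `hU` of the refuted box.
    refine h fun hU t _ hst => ?_
    exact hall _ _ _ hU (AAML.refines_update hst)
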